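/- \textbf{Theorem.} A (set-theoretic) solution of the Yang--Baxter equation is a pair $(X,r)$ with $X$ a non-empty set and $r\colon X\times X\to X\times X$ a map satisfying $(r\times \mathrm{id})(\mathrm{id}\times r)(r\times \mathrm{id})=(\mathrm{id}\times r)(r\times \mathrm{id})(\mathrm{id}\times r)$. Write $r(x,y)=(\lambda_x(y),\rho_y(x))$; the solution is non-degenerate if all $\lambda_x$ and $\rho_y$ are bijective. It is a Lyubashenko solution if $r(x,y)=(\lambda(y),\rho(x))$ for all $x,y$, for some commuting permutations $\lambda,\rho$ of $X$. It is simple if every epimorphic image of $(X,r)$ is isomorphic to $(X,r)$ or is a solution on a singleton. Let $(X,r)$ be a finite non-degenerate solution, and put $\sigma_y(x)=\lambda_y\rho_{\lambda_x^{-1}(y)}(x)$, a permutation $\sigma_y$ of $X$. A skew left brace is a set $B$ with two group structures $+$ and $\circ$ such that $a\circ(b+c)=a\circ b-a+a\circ c$; an ideal of $B$ is an additive subgroup that is invariant under all maps $b\mapsto -a+a\circ b$, is normal in $(B,+)$ and is a normal subgroup of $(B,\circ)$. The permutation skew left brace $\mathcal G$ of $(X,r)$ consists of the pairs $\gamma_a=(\sigma_a^{-1},\lambda_a)$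 with $a$ in the structure monoid of $(X,r)$; explicitly, it is the subgroup of $\mathrm{Sym}(X)\rtimes\mathrm{Sym}(X)$ (conjugation action, multiplication $(s,l)\circ(s',l')=(s\,ls'l^{-1},ll')$) generated by the elements $\gamma_x=(\sigma_x^{-1},\lambda_x)$, $x\in X$, and its addition is the unique group operation with $g+\gamma_x=g\circ\gamma_{l^{-1}(x)}$ for all $g=(s,l)\in\mathcal G$ and $x\in X$. The solution is irretractable if $x\mapsto\gamma_x$ is injective on $X$. Let $\mathcal C$ be the group generated by the permutations $\sigma_x$, regarded as a trivial skew left brace (addition and multiplication are both composition), and let $\mathcal S=\mathcal C\rtimes\mathcal G$ be the skew left brace with componentwise addition and multiplication $(c,(s,l))\circ(c',g')=(c\,lc'l^{-1},(s,l)\circ g')$. The group $(\mathcal S,\circ)$ acts on $X$ by $(c,(s,l))\cdot x=c(l(x))$. Let $\mathcal D$ be the additive subgroup of $\mathcal G$ generated by all $\gamma_x-\gamma_y$, let $\mathcal D'$ be the subgroup of $\mathcal C$ generated by all $\sigma_x\sigma_y^{-1}$ ($x,y\in X$), and let $\mathbb D=\mathcal D'\rtimes\mathcal D\subseteq\mathcal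 S$. Assume that $|X|>1$ and that $(X,r)$ is not a Lyubashenko solution. Then $(X,r)$ is simple if and only if the following three conditions hold: \begin{enumerate} \item $(X,r)$ is irretractable; \item $\mathcal D$ is the smallest non-zero ideal of $\mathcal G$; \item $\mathbb D$ acts transitively on $X$. \end{enumerate} -/

import Mathlib

open Equiv

/-! ### Skew left braces -/

/-- A skew left brace: a type with a group structure `+` (not assumed commutative) and a group
structure `*` (the circle operation) such that `a * (b + c) = a * b - a + a * c`. -/
class IsSkewBrace (B : Type*) [AddGroup B] [Group B] : Prop where
  mul_add' : ∀ a b c : B, a * (b + c) = a * b + -a + a * c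

/-- An ideal of a skew left brace: an additive subgroup `I` that is invariant under all maps
`b ↦ -a + a * b`, is normal in the additive group, and is a normal subgroup of the
multiplicative group. -/
structure IsSkewBrace.IsIdeal {B : Type*} [AddGroup B] [Group B] [IsSkewBrace B]
    (I : AddSubgroup B) : Prop where
  lam_mem : ∀ a : B, ∀ i ∈ I, -a + a * i ∈ I
  add_normal : I.Normal
  mul_normal : ∃ N : Subgroup B, N.Normal ∧ (N : Set B) = (I : Set B)

section Semidirect

open scoped SemidirectProduct

variable {C B : Type*} [Group C] [Group B] [AddGroup B] (φ : B →* MulAut C)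

/-- The semidirect product `C ⋊ B` of a group `C`, regarded as a trivial skew left brace
(`c + c' = c * c'`), and a skew left brace `B`: the multiplication is the one of the semidirect
product of groups and the addition is componentwise. -/
instance semidirectAddGroup : AddGroup (C ⋊[φ] B) :=
  letI : Add (C ⋊[φ] B) := ⟨fun s t => ⟨s.left * t.left, s.right + t.right⟩⟩
  letI : Zero (C ⋊[φ] B) := ⟨⟨1, 0⟩⟩
  letI : Neg (C ⋊[φ] B) := ⟨fun s => ⟨s.left⁻¹, -s.right⟩⟩
  AddGroup.ofLeftAxioms
    (fun _ _ _ => SemidirectProduct.ext (mul_assoc _ _ _) (add_assoc _ _ _))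
    (fun _ => SemidirectProduct.ext (one_mul _) (zero_add _))
    (fun _ => SemidirectProduct.ext (inv_mul_cancel _) (neg_add_cancel _))

@[simp] theorem semidirect_add_left (s t : C ⋊[φ] B) : (s + t).left = s.left * t.left := rfl
@[simp] theorem semidirect_add_right (s t : C ⋊[φ] B) : (s + t).right = s.right + t.right := rfl
@[simp] theorem semidirect_neg_left (s : C ⋊[φ] B) : (-s).left = s.left⁻¹ := rfl
@[simp] theorem semidirect_neg_right (s : C ⋊[φ] B) : (-s).right = -s.right := rfl
@[simp] theorem semidirect_zero_left : (0 : C ⋊[φ] B).left = 1 := rfl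
@[simp] theorem semidirect_zero_right : (0 : C ⋊[φ] B).right = 0 := rfl

instance semidirectIsSkewBrace [IsSkewBrace B] : IsSkewBrace (C ⋊[φ] B) where
  mul_add' a b c := by
    ext
    · simp [mul_assoc]
    · simpa using IsSkewBrace.mul_add' a.right b.right c.right

end Semidirect

/-! ### Set-theoretic solutions of the Yang-Baxter equation -/

/-- A map `r : X × X → X × X` satisfying the braid equation
`(r × id)(id × r)(r × id) = (id × r)(r × id)(id × r)`. -/
structure YBSolution (X : Type*) where
  r : X × X → X × X
  braid : ∀ x y z : X,
    (fun t : X × X × X => ((r (t.1, t.2.1)).1, (r (t.1, t.2.1)).2, t.2.2))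
      ((fun t : X × X × X => (t.1, r t.2))
        ((fun t : X × X × X => ((r (t.1, t.2.1)).1, (r (t.1, t.2.1)).2, t.2.2)) (x, y, z))) =
    (fun t : X × X × X => (t.1, r t.2))
      ((fun t : X × X × X => ((r (t.1, t.2.1)).1, (r (t.1, t.2.1)).2, t.2.2))
        ((fun t : X × X × X => (t.1, r t.2)) (x, y, z)))

namespace YBSolution

universe u v

/-- `f : X → Y` is a morphism of solutions. -/
def IsMorphism {X : Type u} {Y : Type v} (S : YBSolution X) (T : YBSolution Y) (f : X → Y) :
    Prop :=
  ∀ x y, T.r (f x, f y) = (f (S.r (x, y)).1, f (S.r (x, y)).2)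

/-- A solution is simple if each of its epimorphic images is isomorphic to it or lives on a
singleton. -/
def IsSimple {X : Type u} (S : YBSolution X) : Prop :=
  ∀ (Y : Type u) (T : YBSolution Y) (f : X → Y), Function.Surjective f → S.IsMorphism T f →
    (∃ e : X ≃ Y, S.IsMorphism T e) ∨ Nat.card Y = 1

/-- `r (x, y) = (lam y, rho x)` for two commuting permutations of `X`. -/
def IsLyubashenko {X : Type u} (S : YBSolution X) : Prop :=
  ∃ lam rho : Perm X, Commute lam rho ∧ ∀ x y, S.r (x, y) = (lam y, rho x)

end YBSolution

/-- A non-degenerate solution: writing `r (x, y) = (lam x y, rho y x)`, all the maps `lam x` and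
`rho y` are bijective. -/
structure NondegSolution (X : Type*) extends YBSolution X where
  lam_bijective : ∀ x, Function.Bijective fun y => (r (x, y)).1
  rho_bijective : ∀ y, Function.Bijective fun x => (r (x, y)).2

namespace NondegSolution

open scoped SemidirectProduct

universe u

variable {X : Type u} (S : NondegSolution X)

/-- `lam x y` is the first component of `r (x, y)`. -/
noncomputable def lam (x : X) : Perm X := Equiv.ofBijective _ (S.lam_bijective x)

/-- `rho y x` is the second component of `r (x, y)`. -/
noncomputable def rho (y : X) : Perm X := Equiv.ofBijective _ (S.rho_bijective y)

theorem apply_inv_aux {Z : Type*} (p : Perm Z) (z : Z) : p (p⁻¹ z) = z := p.apply_symm_apply z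

theorem inv_apply_aux {Z : Type*} (p : Perm Z) (z : Z) : p⁻¹ (p z) = z := p.symm_apply_apply z

theorem lam_lam (x y : X) : S.lam x * S.lam y = S.lam (S.lam x y) * S.lam (S.rho y x) := by
  ext z
  exact (congrArg (fun t => t.1) (S.braid x y z)).symm

theorem rho_lam (x y z : X) : S.rho (S.lam (S.rho y x) z) (S.lam x y) =
    S.lam (S.rho (S.lam y z) x) (S.rho z y) :=
  congrArg (fun t => t.2.1) (S.braid x y z)

theorem rho_rho (y z : X) : S.rho z * S.rho y = S.rho (S.rho z y) * S.rho (S.lam y z) := by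
  ext x
  exact congrArg (fun t => t.2.2) (S.braid x y z)

/-- The map `sigma_y (x) = lam_y (rho_{lam_x⁻¹ (y)} (x))` of the left derived solution. -/
noncomputable def sigmaFun (y x : X) : X := S.lam y (S.rho ((S.lam x)⁻¹ y) x)

theorem sigmaFun_lam_self (a b : X) :
    S.sigmaFun (S.lam a b) a = S.lam (S.lam a b) (S.rho b a) := by
  simp [sigmaFun]

theorem sigmaFun_lam (a b c : X) :
    S.sigmaFun (S.lam a b) (S.lam a c) = S.lam a (S.sigmaFun b c) := by
  obtain ⟨d, rfl⟩ := (S.lam c).surjective b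
  have h1 := congrArg (fun p : Perm X => p d) (S.lam_lam a c)
  simp only [Perm.mul_apply] at h1
  have h2 := congrArg (fun p : Perm X => p (S.rho d c)) (S.lam_lam a (S.lam c d))
  simp only [Perm.mul_apply] at h2
  rw [h1, sigmaFun_lam_self, ← h1, rho_lam, ← h2]
  simp [sigmaFun]

/-- The diagonal map `x ↦ lam_x⁻¹ (x)`. -/
noncomputable def diag (x : X) : X := (S.lam x)⁻¹ x

theorem lam_diag (x : X) : S.lam x (S.diag x) = x := by simp [diag]

theorem rho_diag (x : X) : S.rho (S.diag x) x = S.sigmaFun (S.diag x) (S.diag x) := by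
  apply (S.lam x).injective
  rw [← sigmaFun_lam, lam_diag]
  rfl

theorem diag_injective : Function.Injective S.diag := by
  intro x y h
  have hx := S.rho_diag x
  rw [h, ← S.rho_diag y] at hx
  exact (S.rho _).injective hx

theorem sigmaFun_diag (b a : X) :
    S.sigmaFun b (S.diag a) = S.lam b (S.diag (S.rho b a)) := by
  have h2 := congrArg (fun p : Perm X => p ((S.lam b)⁻¹ (S.sigmaFun b (S.diag a))))
    (S.lam_lam a b)
  simp only [Perm.mul_apply] at h2
  rw [apply_inv_aux, ← sigmaFun_lam, lam_diag, sigmaFun_lam_self] at h2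
  have h3 := (S.lam (S.lam a b)).injective h2
  have h4 : (S.lam (S.rho b a))⁻¹ (S.rho b a) = (S.lam b)⁻¹ (S.sigmaFun b (S.diag a)) := by
    rw [Perm.inv_eq_iff_eq]
    exact h3
  rw [diag.eq_1 S (S.rho b a), h4, apply_inv_aux]

variable [Finite X]

/-- The diagonal map as a permutation. -/
noncomputable def diagPerm : Perm X :=
  Equiv.ofBijective S.diag (Finite.injective_iff_bijective.mp S.diag_injective)

theorem sigmaFun_eq (b : X) :
    S.sigmaFun b = (S.lam b * S.diagPerm * S.rho b * S.diagPerm⁻¹ : Perm X) := by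
  ext x
  obtain ⟨a, rfl⟩ := S.diagPerm.surjective x
  simpa [diagPerm] using S.sigmaFun_diag b a

/-- `sigma_y` as a permutation of `X`:
`sigma_y (x) = lam_y (rho_{lam_x⁻¹ (y)} (x))`. -/
noncomputable def sigma (y : X) : Perm X :=
  Equiv.ofBijective (S.sigmaFun y) (by rw [sigmaFun_eq]; exact Equiv.bijective _)

theorem sigma_apply (y x : X) : S.sigma y x = S.lam y (S.rho ((S.lam x)⁻¹ y) x) := rfl

theorem sigma_eq (b : X) : S.sigma b = S.lam b * S.diagPerm * S.rho b * S.diagPerm⁻¹ :=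
  Equiv.coe_fn_injective (S.sigmaFun_eq b)

theorem sigma_lam (a b : X) : S.sigma (S.lam a b) = S.lam a * S.sigma b * (S.lam a)⁻¹ := by
  rw [eq_mul_inv_iff_mul_eq]
  ext c
  exact S.sigmaFun_lam a b c

theorem sigma_sigma (a b : X) : S.sigma a * S.sigma b = S.sigma (S.sigma a b) * S.sigma a := by
  obtain ⟨d, rfl⟩ := (S.lam b).surjective a
  have e1 : S.sigma (S.lam b d) b = S.lam (S.lam b d) (S.rho d b) := S.sigmaFun_lam_self b d
  have h1 := S.lam_lam b d
  have h2 := S.rho_rho b d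
  calc S.sigma (S.lam b d) * S.sigma b
      = (S.lam b * S.lam d) * S.diagPerm * (S.rho d * S.rho b) * S.diagPerm⁻¹ := by
        rw [sigma_lam, sigma_eq S d, sigma_eq S b]; group
    _ = S.sigma (S.sigma (S.lam b d) b) * S.sigma (S.lam b d) := by
        rw [h1, h2, e1, sigma_lam, sigma_eq S (S.rho d b), sigma_eq S (S.lam b d)]; group

/-! ### The permutation skew left brace -/

/-- `gamma x = (sigma_x⁻¹, lam_x)`, as an element of the semidirect product `Sym X ⋊ Sym X` with
respect to conjugation. -/
noncomputable def gammaPair (x : X) : Perm X ⋊[MulAut.conj] Perm X := ⟨(S.sigma x)⁻¹, S.lam x⟩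

/-- The underlying set of the permutation skew left brace: the set of all pairs
`gamma_a = (sigma_a⁻¹, lam_a)`, where `a` runs through the structure monoid of `(X, r)`.
Since `lam_{a ∘ b} = lam_a lam_b` and
`sigma_{a ∘ b} = sigma_{lam_a (b)} sigma_a = lam_a sigma_b lam_a⁻¹ sigma_a`, the operation
`gamma_a ∘ gamma_b = gamma_{a ∘ b}` is the multiplication of the semidirect product
`Sym X ⋊ Sym X`, so that this is the subgroup (equivalently, as `X` is finite, the submonoid)
generated by the `gamma_x` with `x ∈ X`. -/
noncomputable abbrev PermBrace : Type u := ↥(Subgroup.closure (Set.range S.gammaPair))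

/-- The canonical map from `X` to the permutation skew left brace. -/
noncomputable def gamma (x : X) : S.PermBrace :=
  ⟨S.gammaPair x, Subgroup.subset_closure ⟨x, rfl⟩⟩

/-- The permutation `lam_a` of `X` attached to `g = gamma_a`. -/
noncomputable def lamOf : S.PermBrace →* Perm X :=
  SemidirectProduct.rightHom.comp (Subgroup.subtype _)

/-- The permutation `sigma_a⁻¹` of `X` attached to `g = gamma_a`. -/
noncomputable def sigmaInvOf (g : S.PermBrace) : Perm X := g.1.left

@[simp] theorem lamOf_gamma (x : X) : S.lamOf (S.gamma x) = S.lam x := rfl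
@[simp] theorem sigmaInvOf_gamma (x : X) : S.sigmaInvOf (S.gamma x) = (S.sigma x)⁻¹ := rfl

theorem sigmaInvOf_mul (g h : S.PermBrace) : S.sigmaInvOf (g * h) =
    S.sigmaInvOf g * (S.lamOf g * S.sigmaInvOf h * (S.lamOf g)⁻¹) := rfl

theorem permBrace_ext {g h : S.PermBrace} (h1 : S.sigmaInvOf g = S.sigmaInvOf h)
    (h2 : S.lamOf g = S.lamOf h) : g = h :=
  Subtype.ext (SemidirectProduct.ext h1 h2)

instance : Finite S.PermBrace :=
  Finite.of_injective (fun g => (S.sigmaInvOf g, S.lamOf g)) fun _ _ h =>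
    S.permBrace_ext (congrArg Prod.fst h) (congrArg Prod.snd h)

theorem permBrace_induction {p : S.PermBrace → Prop} (one : p 1)
    (mul : ∀ g x, p g → p (g * S.gamma x)) (g : S.PermBrace) : p g := by
  have key : Submonoid.closure (Set.range S.gamma) = ⊤ := by
    rw [← Subgroup.closure_toSubmonoid_of_finite]
    have : Set.range S.gamma = (Subtype.val ⁻¹' (Set.range S.gammaPair)) := by
      ext h
      constructor
      · rintro ⟨x, rfl⟩
        exact ⟨x, rfl⟩
      · rintro ⟨x, hx⟩
        exact ⟨x, Subtype.ext hx⟩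
    rw [this, Subgroup.closure_closure_coe_preimage]
    rfl
  have hg : g ∈ Submonoid.closure (Set.range S.gamma) := by rw [key]; trivial
  induction hg using Submonoid.closure_induction_right with
  | one => exact one
  | mul_right y hy z hz ih =>
    obtain ⟨x, rfl⟩ := hz
    exact mul y x ih

/-- Right addition of `gamma_x`: `gamma_a + gamma_x = gamma_{a + x}` with
`a + x = a ∘ lam_a⁻¹ (x)`. -/
noncomputable def addRightFun (x : X) (g : S.PermBrace) : S.PermBrace :=
  g * S.gamma ((S.lamOf g)⁻¹ x)

theorem addRightFun_injective (x : X) : Function.Injective (S.addRightFun x) := by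
  intro g h e
  have key : ∀ k : S.PermBrace, (S.lamOf (S.addRightFun x k))⁻¹ x =
      S.diag ((S.lamOf k)⁻¹ x) := by
    intro k
    simp [addRightFun, diag]
  have hd := S.diag_injective ((key g).symm.trans ((congrArg (fun k => (S.lamOf k)⁻¹ x) e).trans
    (key h)))
  unfold addRightFun at e
  rw [hd] at e
  exact mul_right_cancel e

/-- Right addition of `gamma_x` as a permutation. -/
noncomputable def addRight (x : X) : Perm S.PermBrace :=
  Equiv.ofBijective (S.addRightFun x)
    (Finite.injective_iff_bijective.mp (S.addRightFun_injective x))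

theorem addRight_apply (x : X) (g : S.PermBrace) :
    S.addRight x g = g * S.gamma ((S.lamOf g)⁻¹ x) := rfl

/-- Left addition of `gamma_x`: `gamma_x + gamma_a = gamma_{x + a}` with
`x + a = a + sigma_a (x) = a ∘ lam_a⁻¹ (sigma_a (x))`. -/
noncomputable def addLeftFun (x : X) (g : S.PermBrace) : S.PermBrace :=
  g * S.gamma ((S.lamOf g)⁻¹ ((S.sigmaInvOf g)⁻¹ x))

theorem gamma_mul_gamma (w z : X) : S.gamma w * S.gamma ((S.lam w)⁻¹ z) =
    S.gamma z * S.gamma ((S.lam z)⁻¹ (S.sigma z w)) := by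
  obtain ⟨b, rfl⟩ := (S.lam w).surjective z
  have e1 : S.sigma (S.lam w b) w = S.lam (S.lam w b) (S.rho b w) := S.sigmaFun_lam_self w b
  have h1 := S.sigma_sigma (S.lam w b) w
  rw [e1, sigma_lam S (S.lam w b) (S.rho b w)] at h1
  rw [e1]
  apply S.permBrace_ext
  · rw [sigmaInvOf_mul, sigmaInvOf_mul]
    simp only [sigmaInvOf_gamma, lamOf_gamma, inv_apply_aux]
    have h2 := congrArg (fun p : Perm X => p⁻¹) h1
    simp only [mul_inv_rev, inv_inv] at h2
    rw [sigma_lam S w b] at h2 ⊢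
    simp only [mul_inv_rev, inv_inv, mul_assoc] at h2 ⊢
    exact h2
  · simpa using S.lam_lam w b

theorem addRight_addLeft (x y : X) (g : S.PermBrace) :
    S.addRight y (S.addLeftFun x g) = S.addLeftFun x (S.addRight y g) := by
  have h := S.gamma_mul_gamma ((S.lamOf g)⁻¹ ((S.sigmaInvOf g)⁻¹ x)) ((S.lamOf g)⁻¹ y)
  rw [addRight_apply, addRight_apply, addLeftFun, addLeftFun, mul_assoc, mul_assoc]
  simp only [map_mul, lamOf_gamma, sigmaInvOf_mul, sigmaInvOf_gamma, mul_inv_rev, inv_inv,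
    Perm.mul_apply, inv_apply_aux] at h ⊢
  rw [h]

/-- The group generated by the right additions of the `gamma_x`. -/
noncomputable def addRightGroup : Subgroup (Perm S.PermBrace) :=
  Subgroup.closure (Set.range S.addRight)

theorem addRightGroup_comm {p : Perm S.PermBrace} (hp : p ∈ S.addRightGroup) (x : X) :
    ∀ g, p (S.addLeftFun x g) = S.addLeftFun x (p g) := by
  induction hp using Subgroup.closure_induction with
  | mem p hp =>
    obtain ⟨y, rfl⟩ := hp
    exact S.addRight_addLeft x y
  | one => intro g; rfl
  | mul p q _ _ hp hq => intro g; rw [Perm.mul_apply, hq, hp, Perm.mul_apply]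
  | inv p _ hp => intro g; rw [Perm.inv_eq_iff_eq, hp, apply_inv_aux]

theorem addRightGroup_free {p : Perm S.PermBrace} (hp : p ∈ S.addRightGroup) (h1 : p 1 = 1) :
    p = 1 := by
  ext1 g
  induction g using S.permBrace_induction with
  | one => exact h1
  | mul g x ih =>
    have e : g * S.gamma x = S.addLeftFun (S.sigmaInvOf g (S.lamOf g x)) g := by
      simp [addLeftFun]
    rw [e, S.addRightGroup_comm hp, ih]
    rfl

theorem addRightGroup_transitive (g : S.PermBrace) : ∃ p ∈ S.addRightGroup, p 1 = g := by
  induction g using S.permBrace_induction with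
  | one => exact ⟨1, one_mem _, rfl⟩
  | mul g x ih =>
    obtain ⟨p, hp, rfl⟩ := ih
    refine ⟨S.addRight (S.lamOf (p 1) x) * p,
      mul_mem (Subgroup.subset_closure ⟨_, rfl⟩) hp, ?_⟩
    simp [addRight_apply]

/-- The group generated by the right additions of the `gamma_x` acts regularly. -/
noncomputable def addRightEquiv : S.addRightGroup ≃ S.PermBrace :=
  Equiv.ofBijective (fun p => p.1 1)
    ⟨fun p q h => by
      have := S.addRightGroup_free (mul_mem (inv_mem q.2) p.2)
        (by rw [Perm.mul_apply, Perm.inv_eq_iff_eq]; exact h)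
      exact Subtype.ext (inv_mul_eq_one.mp this).symm,
    fun g => by
      obtain ⟨p, hp, h⟩ := S.addRightGroup_transitive g
      exact ⟨⟨p, hp⟩, h⟩⟩

/-- Right addition of `h`: the unique permutation in the group generated by the right additions
of the `gamma_x` that maps the identity to `h`. -/
noncomputable def addRightOf (h : S.PermBrace) : S.addRightGroup := S.addRightEquiv.symm h

theorem addRightOf_one (h : S.PermBrace) : (S.addRightOf h).1 1 = h :=
  S.addRightEquiv.apply_symm_apply h

theorem addRightOf_eq (p : S.addRightGroup) : S.addRightOf (p.1 1) = p :=
  S.addRightEquiv.symm_apply_apply p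

theorem addRightOf_addRightOf (g h : S.PermBrace) :
    S.addRightOf ((S.addRightOf h).1 g) = S.addRightOf h * S.addRightOf g := by
  rw [← S.addRightOf_eq (S.addRightOf h * S.addRightOf g)]
  simp [addRightOf_one]

/-- The addition `gamma_a + gamma_b = gamma_{a + b}`. It is determined by associativity and
`gamma_a + gamma_x = gamma_a ∘ gamma_{lam_a⁻¹ (x)}` for `x ∈ X` (see `add_gamma`). -/
noncomputable instance : AddGroup S.PermBrace :=
  letI : Add S.PermBrace := ⟨fun g h => (S.addRightOf h).1 g⟩
  letI : Zero S.PermBrace := ⟨1⟩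
  letI : Neg S.PermBrace := ⟨fun g => (S.addRightOf g).1⁻¹ 1⟩
  AddGroup.ofLeftAxioms
    (fun g h k => by
      change (S.addRightOf k).1 ((S.addRightOf h).1 g) =
        (S.addRightOf ((S.addRightOf k).1 h)).1 g
      rw [addRightOf_addRightOf]; rfl)
    (fun g => S.addRightOf_one g)
    (fun g => by
      change (S.addRightOf g).1 ((S.addRightOf g).1⁻¹ 1) = 1
      simp)

theorem permBrace_add_def (g h : S.PermBrace) : g + h = (S.addRightOf h).1 g := rfl

theorem permBrace_zero_def : (0 : S.PermBrace) = 1 := rfl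

/-- `gamma_a + gamma_x = gamma_a ∘ gamma_{lam_a⁻¹ (x)}`. -/
theorem add_gamma (g : S.PermBrace) (x : X) :
    g + S.gamma x = g * S.gamma ((S.lamOf g)⁻¹ x) := by
  have h := S.addRightOf_eq ⟨S.addRight x, Subgroup.subset_closure ⟨x, rfl⟩⟩
  have e : S.addRight x 1 = S.gamma x := by simp [addRight_apply]
  simp only [e] at h
  rw [permBrace_add_def, h, addRight_apply]

theorem conj_mem_addRightGroup (g : S.PermBrace) {p : Perm S.PermBrace}
    (hp : p ∈ S.addRightGroup) :
    Equiv.mulLeft g * p * (Equiv.mulLeft g)⁻¹ ∈ S.addRightGroup := by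
  induction hp using Subgroup.closure_induction with
  | mem p hp =>
    obtain ⟨x, rfl⟩ := hp
    refine Subgroup.subset_closure ⟨S.lamOf g x, ?_⟩
    rw [eq_mul_inv_iff_mul_eq]
    ext1 h
    simp [addRight_apply, mul_assoc]
  | one => rw [mul_one, mul_inv_cancel]; exact one_mem _
  | mul p q _ _ hp hq =>
    have := mul_mem hp hq
    rwa [conj_mul] at this
  | inv p _ hp =>
    have := inv_mem hp
    rwa [conj_inv] at this

/-- The permutation skew left brace is a skew left brace. -/
instance : IsSkewBrace S.PermBrace where
  mul_add' g h k := by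
    let q : S.addRightGroup :=
      ⟨_, S.conj_mem_addRightGroup g (S.addRightOf k).2⟩
    have hq : ∀ m, q.1 (g * m) = g * (m + k) := by
      intro m
      change (Equiv.mulLeft g * (S.addRightOf k).1 * (Equiv.mulLeft g)⁻¹) (Equiv.mulLeft g m) = _
      simp only [Perm.mul_apply, inv_apply_aux]
      rfl
    have h0 : q.1 g = g * k := by
      have := hq 1
      rwa [mul_one, ← permBrace_zero_def, zero_add] at this
    have h1 : S.addRightOf (-g + g * k) = q := by
      rw [← S.addRightOf_eq q]
      congr 1
      rw [neg_add_eq_iff_eq_add, ← h0]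
      have h2 := congrArg (fun p => p.1 1) (S.addRightOf_addRightOf g (q.1 1))
      rw [S.addRightOf_eq q] at h2
      simp only [addRightOf_one] at h2
      rw [permBrace_add_def, S.addRightOf_eq q]
    rw [add_assoc, permBrace_add_def S (g * h), h1, hq]

/-- `lam_{gamma_x} (gamma_y) = gamma_{lam_x (y)}` in the permutation skew left brace. -/
theorem lam_gamma (g : S.PermBrace) (y : X) :
    -g + g * S.gamma y = S.gamma (S.lamOf g y) := by
  rw [neg_add_eq_iff_eq_add, add_gamma]
  simp

/-! ### The skew left braces `C` and `C ⋊ G` -/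

/-- The group `C` generated by the permutations `sigma_x`, regarded as a trivial skew left
brace. -/
noncomputable def sigmaGroup : Subgroup (Perm X) := Subgroup.closure (Set.range S.sigma)

theorem lamOf_mem_normalizer (g : S.PermBrace) :
    S.lamOf g ∈ Subgroup.normalizer (S.sigmaGroup : Set (Perm X)) := by
  induction g using S.permBrace_induction with
  | one => rw [map_one]; exact one_mem _
  | mul g x ih =>
    rw [map_mul]
    refine mul_mem ih ?_
    rw [lamOf_gamma, Subgroup.mem_normalizer_iff_map_conj_eq, sigmaGroup, MonoidHom.map_closure,
      ← Set.range_comp]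
    congr 1
    rw [← (S.lam x).surjective.range_comp S.sigma]
    congr 1
    ext1 y
    simp [sigma_lam]

/-- The action of the multiplicative group of the permutation skew left brace on `C`:
`gamma_a · sigma_b = lam_a sigma_b lam_a⁻¹`. -/
noncomputable def sigmaGroupAct : S.PermBrace →* MulAut S.sigmaGroup :=
  (Subgroup.normalizerMonoidHom S.sigmaGroup).comp
    (S.lamOf.codRestrict _ S.lamOf_mem_normalizer)

theorem sigmaGroupAct_apply (g : S.PermBrace) (c : S.sigmaGroup) :
    (S.sigmaGroupAct g c : Perm X) = S.lamOf g * c * (S.lamOf g)⁻¹ := rfl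

/-- The skew left brace `C ⋊ G`, where `G` is the permutation skew left brace. -/
noncomputable abbrev SBrace : Type u := S.sigmaGroup ⋊[S.sigmaGroupAct] S.PermBrace

/-- The multiplicative group of `C ⋊ G` acts on `X` by
`(sigma_a, gamma_b) · x = sigma_a (lam_b (x))`. -/
noncomputable instance : MulAction S.SBrace X where
  smul s x := (s.left : Perm X) (S.lamOf s.right x)
  one_smul x := rfl
  mul_smul s t x := by
    change ((s * t).left : Perm X) (S.lamOf (s * t).right x) =
      (s.left : Perm X) (S.lamOf s.right ((t.left : Perm X) (S.lamOf t.right x)))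
    simp [SemidirectProduct.mul_left, sigmaGroupAct_apply]

/-- The additive subgroup of the permutation skew left brace generated by all
`gamma_x - gamma_y`. -/
noncomputable def idealD : AddSubgroup S.PermBrace :=
  AddSubgroup.closure (Set.range fun p : X × X => S.gamma p.1 + -S.gamma p.2)

/-- `sigma_x` as an element of `C`. -/
noncomputable def sigmaC (x : X) : S.sigmaGroup := ⟨S.sigma x, Subgroup.subset_closure ⟨x, rfl⟩⟩

/-- The subgroup of `C` generated by all differences `sigma_x - sigma_y`, where the addition of
the trivial skew left brace `C` is the composition of permutations. -/
noncomputable def subgroupD' : Subgroup S.sigmaGroup :=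
  Subgroup.closure (Set.range fun p : X × X => S.sigmaC p.1 * (S.sigmaC p.2)⁻¹)

/-- The subset `D' ⋊ D` of `C ⋊ G`, as an additive subgroup. -/
noncomputable def idealDD : AddSubgroup S.SBrace where
  carrier := {s | s.left ∈ S.subgroupD' ∧ s.right ∈ S.idealD}
  zero_mem' := ⟨one_mem _, zero_mem _⟩
  add_mem' hs ht := ⟨mul_mem hs.1 ht.1, add_mem hs.2 ht.2⟩
  neg_mem' hs := ⟨inv_mem hs.1, neg_mem hs.2⟩

/-- The solution is irretractable: the map `x ↦ gamma_x` is injective on `X`. -/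
def IsIrretractable : Prop := Function.Injective S.gamma

end NondegSolution

/-!
Epimorphic images of a finite non-degenerate solution `(X, r)` are again non-degenerate, and they
correspond to the equivalence relations on `X` that are compatible with both arguments of
`lam` and `sigma` (`IsCongruence`). So `(X, r)` is simple precisely when the only congruences are
equality and the total relation.

If `(X, r)` is simple, congruences are produced from two sources. Every ideal `I` of the
permutation skew left brace yields the congruence `-gamma x + gamma y ∈ I`
(`isCongruence_idealSetoid`). For `I = 0` this gives irretractability, the total relation being
excluded because constancy of `gamma` makes `r` a Lyubashenko solution. For `I ≠ 0` the relation
cannot be equality: every `i ∈ I` moves `x` only inside its class, so otherwise `i` would act on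
`X` trivially through both of its components and be `0`. Hence the relation is total, which says
that `D ≤ I`. The orbits of `D' ⋊ D` form the other congruence (`isCongruence_orbitSetoid`), and if
it were equality then `lam` and `sigma` would be constant.

Conversely, an epimorphism `f : X → Y` induces a homomorphism of permutation skew left braces
(`exists_permBrace_hom`). If `f` identifies two points, irretractability makes its kernel a
non-zero ideal, so the kernel contains `D`. Then `D' ⋊ D` preserves the fibres of `f`, and
transitivity forces `Y` to be a singleton.
-/

/-! ### Ideals of skew left braces -/

namespace IsSkewBrace

variable {B : Type*} [AddGroup B] [Group B] [IsSkewBrace B]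

theorem one_eq_zero : (1 : B) = 0 := by
  have h := mul_add' (1 : B) 0 0
  simpa using h

theorem lam_add (a b c : B) : -a + a * (b + c) = (-a + a * b) + (-a + a * c) := by
  rw [mul_add']; simp [add_assoc]

theorem lam_zero (a : B) : -a + a * 0 = 0 := by
  rw [← one_eq_zero (B := B), mul_one, neg_add_cancel, one_eq_zero]

theorem lam_neg_add (a b c : B) : -a + a * (-b + c) = -(-a + a * b) + (-a + a * c) := by
  rw [eq_neg_add_iff_add_eq, ← lam_add]; simp

theorem inv_mul_add (a b : B) : a⁻¹ * (a + b) = -a⁻¹ + a⁻¹ * b := by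
  rw [mul_add', inv_mul_cancel, one_eq_zero, zero_add]

/-- An additive subgroup invariant under the maps `b ↦ -a + a * b` is also a multiplicative
subgroup. -/
def mulSubgroup (I : AddSubgroup B) (h : ∀ a : B, ∀ i ∈ I, -a + a * i ∈ I) : Subgroup B where
  carrier := I
  one_mem' := by rw [one_eq_zero]; exact I.zero_mem
  mul_mem' {a b} ha hb := by rw [← add_neg_cancel_left a (a * b)]; exact I.add_mem ha (h a b hb)
  inv_mem' {a} ha := by
    have := h a⁻¹ a ha
    rw [inv_mul_cancel, one_eq_zero, add_zero] at this
    exact I.neg_mem_iff.mp this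

theorem IsIdeal.bot : IsIdeal (⊥ : AddSubgroup B) where
  lam_mem a i hi := by
    rw [AddSubgroup.mem_bot] at hi ⊢
    rw [hi, lam_zero]
  add_normal := inferInstance
  mul_normal := ⟨⊥, inferInstance, by simp [one_eq_zero]⟩

/-- Elements of an ideal act trivially on the quotient by it. -/
theorem IsIdeal.neg_add_lam_mem {I : AddSubgroup B} (hI : IsIdeal I) {i : B} (hi : i ∈ I) (b : B) :
    -b + (-i + i * b) ∈ I := by
  obtain ⟨N, hN, hNI⟩ := hI.mul_normal
  have hmem : ∀ c, c ∈ N ↔ c ∈ I := fun c => Set.ext_iff.mp hNI c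
  have h1 : b⁻¹ * i * b ∈ I := by
    rw [← hmem] at hi ⊢
    simpa using hN.conj_mem i hi b⁻¹
  have h2 := hI.lam_mem b _ h1
  have h3 := hI.add_normal.conj_mem _ (I.neg_mem hi) (-b)
  have e : -b + (-i + i * b) = (-b + -i + - -b) + (-b + b * (b⁻¹ * i * b)) := by
    simp [add_assoc, mul_assoc]
  rw [e]
  exact I.add_mem h3 h2

theorem IsIdeal.inv_mul_mem {I : AddSubgroup B} (hI : IsIdeal I) {a b : B} (h : -a + b ∈ I) :
    a⁻¹ * b ∈ I := by
  have := hI.lam_mem a⁻¹ _ h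
  rwa [← inv_mul_add, add_neg_cancel_left] at this

/-- The kernel of a homomorphism of skew left braces is an ideal. -/
theorem isIdeal_ker {B' : Type*} [AddGroup B'] [Group B'] [IsSkewBrace B'] (F : B →+ B')
    (hF : ∀ a b, F (a * b) = F a * F b) : IsIdeal F.ker where
  lam_mem a i hi := by
    rw [AddMonoidHom.mem_ker] at hi ⊢
    rw [map_add, map_neg, hF, hi, lam_zero]
  add_normal := inferInstance
  mul_normal := by
    refine ⟨(MonoidHom.mk' F hF).ker, inferInstance, ?_⟩
    ext a
    simp [MonoidHom.mem_ker, AddMonoidHom.mem_ker, one_eq_zero]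

end IsSkewBrace

namespace NondegSolution

universe u

/-! ### Morphisms of solutions -/

section Morphisms

variable {X Y : Type u} {S : NondegSolution X} {T : NondegSolution Y} {f : X → Y}

theorem map_lam (hf : S.IsMorphism T.toYBSolution f) (x y : X) :
    f (S.lam x y) = T.lam (f x) (f y) :=
  (congrArg Prod.fst (hf x y)).symm

theorem map_rho (hf : S.IsMorphism T.toYBSolution f) (x y : X) :
    f (S.rho y x) = T.rho (f y) (f x) :=
  (congrArg Prod.snd (hf x y)).symm

theorem map_inv_of_map {p : Perm X} {q : Perm Y} (h : ∀ x, f (p x) = q (f x)) (x : X) :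
    f (p⁻¹ x) = q⁻¹ (f x) := by
  rw [Perm.eq_inv_iff_eq, ← h, apply_inv_aux]

end Morphisms

variable {X : Type u} (S : NondegSolution X) [Finite X]

/-! ### The permutation skew left brace -/

theorem rho_eq (x y : X) : S.rho y x = (S.lam (S.lam x y))⁻¹ (S.sigma (S.lam x y) x) := by
  rw [sigma_apply]; simp

theorem gamma_eq_iff {x y : X} :
    S.gamma x = S.gamma y ↔ S.lam x = S.lam y ∧ S.sigma x = S.sigma y :=
  ⟨fun h => ⟨congrArg S.lamOf h, inv_injective (congrArg S.sigmaInvOf h)⟩,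
    fun h => S.permBrace_ext (congrArg (·⁻¹) h.2) h.1⟩

theorem isLyubashenko_of_const [Nonempty X] (h : ∀ x y, S.gamma x = S.gamma y) :
    S.IsLyubashenko := by
  obtain ⟨a⟩ := ‹Nonempty X›
  have hl : ∀ x, S.lam x = S.lam a := fun x => (S.gamma_eq_iff.mp (h x a)).1
  have hs : ∀ x, S.sigma x = S.sigma a := fun x => (S.gamma_eq_iff.mp (h x a)).2
  have hr : ∀ y, S.rho y = S.rho a := by
    intro y
    ext x
    rw [rho_eq, rho_eq, hl, hs, hl (S.lam x a), hs (S.lam x a)]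
  refine ⟨S.lam a, S.rho a, ?_, fun x y => ?_⟩
  · ext y
    calc S.lam a (S.rho a y) = S.lam (S.rho (S.lam y a) a) (S.rho a y) := by
          rw [hl (S.rho (S.lam y a) a)]
      _ = S.rho (S.lam (S.rho y a) a) (S.lam a y) := (S.rho_lam a y a).symm
      _ = S.rho a (S.lam a y) := by rw [hr (S.lam (S.rho y a) a)]
  · exact Prod.ext (congrArg (fun p : Perm X => p y) (hl x))
      (congrArg (fun p : Perm X => p x) (hr y))

theorem gamma_add (x : X) (g : S.PermBrace) :
    S.gamma x + g = g + S.gamma ((S.sigmaInvOf g)⁻¹ x) := by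
  have h := S.addRightGroup_comm (S.addRightOf g).2 x 1
  rw [addRightOf_one] at h
  have e : S.addLeftFun x 1 = S.gamma x := by
    simp only [addLeftFun, one_mul, map_one, inv_one, Perm.one_apply]
    exact congrArg S.gamma (by rfl)
  rw [e] at h
  rw [permBrace_add_def, h, add_gamma, addLeftFun]

theorem neg_add_gamma_add (x : X) (g : S.PermBrace) :
    -g + S.gamma x + g = S.gamma ((S.sigmaInvOf g)⁻¹ x) := by
  rw [add_assoc, gamma_add, neg_add_cancel_left]

theorem gamma_sigma (z x : X) : S.gamma (S.sigma z x) = -S.gamma z + S.gamma x + S.gamma z := by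
  rw [neg_add_gamma_add, sigmaInvOf_gamma, inv_inv]

theorem permBrace_add_induction {p : S.PermBrace → Prop} (zero : p 0)
    (add : ∀ g x, p g → p (g + S.gamma x)) (g : S.PermBrace) : p g := by
  induction g using S.permBrace_induction with
  | one => exact zero
  | mul g x ih =>
    have := add g (S.lamOf g x) ih
    rwa [add_gamma, inv_apply_aux] at this

theorem lamOf_mul_sigma (g : S.PermBrace) (x : X) :
    S.lamOf g * S.sigma x * (S.lamOf g)⁻¹ = S.sigma (S.lamOf g x) := by
  induction g using S.permBrace_induction generalizing x with
  | one => simp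
  | mul g y ih =>
    simp only [map_mul, lamOf_gamma, Perm.mul_apply, ← ih, sigma_lam]
    group

/-! ### The ideal `D` -/

theorem gamma_add_neg_gamma_mem (x y : X) : S.gamma x + -S.gamma y ∈ S.idealD :=
  AddSubgroup.subset_closure ⟨(x, y), rfl⟩

theorem lam_mem_idealD (g d : S.PermBrace) (hd : d ∈ S.idealD) : -g + g * d ∈ S.idealD := by
  have key : S.idealD ≤ S.idealD.comap
      (AddMonoidHom.mk' (fun d => -g + g * d) (IsSkewBrace.lam_add g)) := by
    rw [idealD, AddSubgroup.closure_le]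
    rintro _ ⟨⟨x, y⟩, rfl⟩
    change (AddMonoidHom.mk' (fun d => -g + g * d) (IsSkewBrace.lam_add g))
      (S.gamma x + -S.gamma y) ∈ S.idealD
    rw [map_add, map_neg]
    simp only [AddMonoidHom.mk'_apply, lam_gamma]
    exact S.gamma_add_neg_gamma_mem _ _
  exact key hd

theorem idealD_normal : S.idealD.Normal := by
  have key : ∀ g d : S.PermBrace, d ∈ S.idealD → -g + d + g ∈ S.idealD := by
    intro g d hd
    have : S.idealD ≤ S.idealD.comap (AddAut.addConj (-g)).toAddMonoidHom := by
      rw [idealD, AddSubgroup.closure_le]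
      rintro _ ⟨⟨x, y⟩, rfl⟩
      have e : -g + (S.gamma x + -S.gamma y) + - -g =
          (-g + S.gamma x + g) + -(-g + S.gamma y + g) := by
        simp [add_assoc]
      change -g + (S.gamma x + -S.gamma y) + - -g ∈ S.idealD
      rw [e, neg_add_gamma_add, neg_add_gamma_add]
      exact S.gamma_add_neg_gamma_mem _ _
    have h := this hd
    change -g + d + - -g ∈ S.idealD at h
    rwa [neg_neg] at h
  exact ⟨fun d hd g => by simpa using key (-g) d hd⟩

theorem neg_gamma_add_gamma_mem (x y : X) : -S.gamma x + S.gamma y ∈ S.idealD := by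
  have := S.idealD_normal.conj_mem _ (S.gamma_add_neg_gamma_mem y x) (-S.gamma x)
  simpa [add_assoc] using this

/-- The quotient of `(G, +)` by `D` is generated by the common class of all `gamma x`, so `G` acts
trivially on it. -/
theorem neg_add_lam_mem_idealD (g h : S.PermBrace) : -h + (-g + g * h) ∈ S.idealD := by
  induction h using S.permBrace_add_induction with
  | zero => rw [IsSkewBrace.lam_zero]; simp
  | add h x ih =>
    have h1 := S.idealD_normal.conj_mem _ ih (-S.gamma x)
    have h2 := S.neg_gamma_add_gamma_mem x (S.lamOf g x)
    have e := add_mem h1 h2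
    rw [← lam_gamma] at e
    rw [IsSkewBrace.lam_add]
    convert e using 1
    simp [add_assoc]

theorem isIdeal_idealD : IsSkewBrace.IsIdeal S.idealD where
  lam_mem := S.lam_mem_idealD
  add_normal := S.idealD_normal
  mul_normal := by
    refine ⟨IsSkewBrace.mulSubgroup _ S.lam_mem_idealD, ⟨fun d hd g => ?_⟩, rfl⟩
    have hd : d ∈ S.idealD := hd
    change g * d * g⁻¹ ∈ S.idealD
    -- `d * h = h + d'` with `d' ∈ D`, for `h = g⁻¹`
    have h1 := S.idealD_normal.conj_mem _ hd (-g⁻¹)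
    have h2 := add_mem h1 (S.neg_add_lam_mem_idealD d g⁻¹)
    have e : -g⁻¹ + d + - -g⁻¹ + (-g⁻¹ + (-d + d * g⁻¹)) = -g⁻¹ + d * g⁻¹ := by
      simp [add_assoc]
    rw [e] at h2
    have h3 := S.lam_mem_idealD g _ h2
    have h4 := IsSkewBrace.inv_mul_add g⁻¹ (-g⁻¹ + d * g⁻¹)
    rw [inv_inv, add_neg_cancel_left] at h4
    rwa [← h4, ← mul_assoc] at h3

theorem idealD_le_iff (I : AddSubgroup S.PermBrace) (hI : I.Normal) :
    S.idealD ≤ I ↔ ∀ x y, -S.gamma x + S.gamma y ∈ I := by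
  refine ⟨fun h x y => h (S.neg_gamma_add_gamma_mem x y), fun h => ?_⟩
  rw [idealD, AddSubgroup.closure_le]
  rintro _ ⟨⟨x, y⟩, rfl⟩
  simpa [add_assoc] using hI.conj_mem _ (h y x) (S.gamma y)

/-! ### Congruences -/

/-- An equivalence relation on `X` compatible with both arguments of `lam` and of `sigma`. -/
structure IsCongruence (c : Setoid X) : Prop where
  lam_left : ∀ {x x'}, c x x' → ∀ y, c (S.lam x y) (S.lam x' y)
  lam_right : ∀ x {y y'}, c y y' → c (S.lam x y) (S.lam x y')
  sigma_left : ∀ {x x'}, c x x' → ∀ y, c (S.sigma x y) (S.sigma x' y)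
  sigma_right : ∀ x {y y'}, c y y' → c (S.sigma x y) (S.sigma x y')

variable {S}

namespace IsCongruence

variable {c : Setoid X}

/-- As `X` is finite, `(lam x)⁻¹` is a power of `lam x`. -/
theorem of_lam_right (hc : S.IsCongruence c) {x y y' : X} (h : c (S.lam x y) (S.lam x y')) :
    c y y' := by
  have key : ∀ n : ℕ, ∀ {z z'}, c z z' → c ((S.lam x ^ n) z) ((S.lam x ^ n) z') := by
    intro n
    induction n with
    | zero => exact fun h => h
    | succ n ih => intro z z' hz; rw [pow_succ]; exact ih (hc.lam_right x hz)
  obtain ⟨n, hn⟩ : ∃ n : ℕ, S.lam x ^ n = (S.lam x)⁻¹ := by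
    have : (S.lam x)⁻¹ ∈ Submonoid.powers (S.lam x) := by
      rw [mem_powers_iff_mem_zpowers]
      exact inv_mem (Subgroup.mem_zpowers _)
    exact this
  have h2 := key n h
  rw [hn, inv_apply_aux, inv_apply_aux] at h2
  exact h2

theorem lam (hc : S.IsCongruence c) {x x' y y' : X} (hx : c x x') (hy : c y y') :
    c (S.lam x y) (S.lam x' y') :=
  c.trans (hc.lam_left hx y) (hc.lam_right x' hy)

theorem rho (hc : S.IsCongruence c) {x x' y y' : X} (hx : c x x') (hy : c y y') :
    c (S.rho y x) (S.rho y' x') := by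
  have hu := hc.lam hx hy
  apply hc.of_lam_right (x := S.lam x y)
  refine c.trans ?_ (c.symm (hc.lam_left hu _))
  rw [rho_eq, rho_eq, apply_inv_aux, apply_inv_aux]
  exact c.trans (hc.sigma_left hu _) (hc.sigma_right _ hx)

/-- The solution induced on the quotient by a congruence. -/
def quotient (hc : S.IsCongruence c) : YBSolution (Quotient c) where
  r p := (Quotient.map₂ (fun x y => (S.r (x, y)).1) (fun _ _ hx _ _ hy => hc.lam hx hy) p.1 p.2,
    Quotient.map₂ (fun x y => (S.r (x, y)).2) (fun _ _ hx _ _ hy => hc.rho hx hy) p.1 p.2)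
  braid := by
    rintro ⟨x⟩ ⟨y⟩ ⟨z⟩
    exact congrArg (fun t : X × X × X =>
      ((Quotient.mk c t.1, Quotient.mk c t.2.1, Quotient.mk c t.2.2) :
        Quotient c × Quotient c × Quotient c)) (S.braid x y z)

theorem eq_or_total (hc : S.IsCongruence c) (hS : S.IsSimple) :
    (∀ x y, c x y → x = y) ∨ ∀ x y, c x y := by
  rcases hS (Quotient c) hc.quotient (Quotient.mk c) Quotient.mk_surjective
    (fun _ _ => rfl) with ⟨e, -⟩ | h
  · left
    have hinj : Function.Injective (Quotient.mk c) :=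
      (Function.Surjective.injective_of_finite e Quotient.mk_surjective)
    exact fun x y h => hinj (Quotient.sound h)
  · right
    have := (Nat.card_eq_one_iff_unique.mp h).1
    exact fun x y => Quotient.exact (Subsingleton.elim _ _)

end IsCongruence

variable (S)

/-! ### The congruence of an ideal -/

/-- Two points are related if their images under `gamma` agree modulo the additive subgroup `I`. -/
def idealSetoid (I : AddSubgroup S.PermBrace) : Setoid X where
  r x y := -S.gamma x + S.gamma y ∈ I
  iseqv :=
    { refl := fun x => by simp
      symm := fun {x y} h => by simpa using I.neg_mem h
      trans := fun {x y z} h1 h2 => by simpa [add_assoc] using I.add_mem h1 h2 }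

variable {S} {I : AddSubgroup S.PermBrace}

theorem idealSetoid_lamOf (hI : IsSkewBrace.IsIdeal I) {i : S.PermBrace} (hi : i ∈ I) (y : X) :
    S.idealSetoid I y (S.lamOf i y) := by
  change -S.gamma y + S.gamma (S.lamOf i y) ∈ I
  rw [← lam_gamma]
  exact hI.neg_add_lam_mem hi _

theorem neg_add_conj_mem_of_normal {A : Type*} [AddGroup A] {J : AddSubgroup A} (hJ : J.Normal) {i : A}
    (hi : i ∈ J) (w : A) : -w + (-i + w + i) ∈ J := by
  have := J.add_mem (hJ.conj_mem _ (J.neg_mem hi) (-w)) hi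
  simpa [add_assoc] using this

theorem idealSetoid_sigmaInvOf (hI : IsSkewBrace.IsIdeal I) {i : S.PermBrace} (hi : i ∈ I)
    (y : X) : S.idealSetoid I y ((S.sigmaInvOf i)⁻¹ y) := by
  change -S.gamma y + S.gamma _ ∈ I
  rw [← neg_add_gamma_add]
  exact neg_add_conj_mem_of_normal hI.add_normal hi _

theorem isCongruence_idealSetoid (hI : IsSkewBrace.IsIdeal I) :
    S.IsCongruence (S.idealSetoid I) := by
  have hr : ∀ g {y y'}, S.idealSetoid I y y' → S.idealSetoid I (S.lamOf g y) (S.lamOf g y') := by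
    intro g y y' h
    change -S.gamma _ + S.gamma _ ∈ I
    rw [← lam_gamma, ← lam_gamma, ← IsSkewBrace.lam_neg_add]
    exact hI.lam_mem g _ h
  refine ⟨fun {x x'} h y => ?_, fun x => hr (S.gamma x), fun {x x'} h y => ?_, fun x y y' h => ?_⟩
  · -- `lam x' = lam x * lamOf j` with `j ∈ I`
    have h2 := hr (S.gamma x) (idealSetoid_lamOf hI (hI.inv_mul_mem h) y)
    rw [← Perm.mul_apply, ← map_mul, mul_inv_cancel_left] at h2
    exact h2
  · have h2 := neg_add_conj_mem_of_normal hI.add_normal h (S.gamma (S.sigma x y))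
    change -S.gamma _ + S.gamma _ ∈ I
    convert h2 using 2
    rw [gamma_sigma, gamma_sigma]
    simp [add_assoc]
  · change -S.gamma _ + S.gamma _ ∈ I
    have h2 := hI.add_normal.conj_mem _ h (-S.gamma x)
    convert h2 using 1
    rw [gamma_sigma, gamma_sigma]
    simp [add_assoc]

/-- An ideal that separates the points of `X` vanishes, since its elements are determined by their
action on `X`. -/
theorem eq_bot_of_idealSetoid (hI : IsSkewBrace.IsIdeal I)
    (h : ∀ x y, S.idealSetoid I x y → x = y) : I = ⊥ := by
  rw [AddSubgroup.eq_bot_iff_forall]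
  intro i hi
  refine S.permBrace_ext (h := 0) ?_ ?_
  · rw [← inv_inj]
    ext x
    exact (h _ _ (idealSetoid_sigmaInvOf hI hi x)).symm
  · ext x
    exact (h _ _ (idealSetoid_lamOf hI hi x)).symm

variable (S)

/-! ### The orbits of `D' ⋊ D` -/

/-- `D'` as a subgroup of the symmetric group. -/
noncomputable def permD' : Subgroup (Perm X) :=
  Subgroup.closure (Set.range fun p : X × X => S.sigma p.1 * (S.sigma p.2)⁻¹)

theorem subgroupD'_map : S.subgroupD'.map S.sigmaGroup.subtype = S.permD' := by
  rw [subgroupD', permD', MonoidHom.map_closure, ← Set.range_comp]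
  rfl

theorem sigma_mul_inv_mem (x y : X) : S.sigma x * (S.sigma y)⁻¹ ∈ S.permD' :=
  Subgroup.subset_closure ⟨(x, y), rfl⟩

theorem conj_mem_permD' {p : Perm X} (f : X → X) (hf : ∀ x, p * S.sigma x * p⁻¹ = S.sigma (f x))
    {c : Perm X} (hc : c ∈ S.permD') : p * c * p⁻¹ ∈ S.permD' := by
  have key : S.permD' ≤ S.permD'.comap (MulAut.conj p).toMonoidHom := by
    rw [permD', Subgroup.closure_le]
    rintro _ ⟨⟨x, y⟩, rfl⟩
    change p * (S.sigma x * (S.sigma y)⁻¹) * p⁻¹ ∈ S.permD'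
    have e : p * (S.sigma x * (S.sigma y)⁻¹) * p⁻¹ =
        (p * S.sigma x * p⁻¹) * (p * S.sigma y * p⁻¹)⁻¹ := by group
    rw [e, hf, hf]
    exact S.sigma_mul_inv_mem _ _
  exact key hc

theorem lamOf_conj_mem_permD' (g : S.PermBrace) {c : Perm X} (hc : c ∈ S.permD') :
    S.lamOf g * c * (S.lamOf g)⁻¹ ∈ S.permD' :=
  S.conj_mem_permD' _ (S.lamOf_mul_sigma g) hc

theorem sigma_conj_mem_permD' (z : X) {c : Perm X} (hc : c ∈ S.permD') :
    S.sigma z * c * (S.sigma z)⁻¹ ∈ S.permD' :=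
  S.conj_mem_permD' (S.sigma z) (fun x => by rw [sigma_sigma, mul_inv_cancel_right]) hc

/-- The image of `D' ⋊ D` in the symmetric group. -/
noncomputable def permDD : Subgroup (Perm X) where
  carrier := {p | ∃ c ∈ S.permD', ∃ d ∈ S.idealD, p = c * S.lamOf d}
  one_mem' := ⟨1, one_mem _, 0, zero_mem _, rfl⟩
  mul_mem' := by
    rintro _ _ ⟨c, hc, d, hd, rfl⟩ ⟨c', hc', d', hd', rfl⟩
    refine ⟨c * (S.lamOf d * c' * (S.lamOf d)⁻¹), mul_mem hc (S.lamOf_conj_mem_permD' d hc'),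
      d * d', (IsSkewBrace.mulSubgroup _ S.lam_mem_idealD).mul_mem hd hd', ?_⟩
    rw [map_mul]; group
  inv_mem' := by
    rintro _ ⟨c, hc, d, hd, rfl⟩
    refine ⟨S.lamOf d⁻¹ * c⁻¹ * (S.lamOf d⁻¹)⁻¹, S.lamOf_conj_mem_permD' _ (inv_mem hc),
      d⁻¹, (IsSkewBrace.mulSubgroup _ S.lam_mem_idealD).inv_mem hd, ?_⟩
    rw [map_inv]; group

theorem mem_permDD_of_mem_permD' {c : Perm X} (hc : c ∈ S.permD') : c ∈ S.permDD :=
  ⟨c, hc, 0, zero_mem _, (mul_one c).symm⟩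

theorem lamOf_mem_permDD {d : S.PermBrace} (hd : d ∈ S.idealD) : S.lamOf d ∈ S.permDD :=
  ⟨1, one_mem _, d, hd, (one_mul _).symm⟩

theorem lamOf_conj_mem_permDD (g : S.PermBrace) {p : Perm X} (hp : p ∈ S.permDD) :
    S.lamOf g * p * (S.lamOf g)⁻¹ ∈ S.permDD := by
  obtain ⟨c, hc, d, hd, rfl⟩ := hp
  obtain ⟨N, hN, hND⟩ := S.isIdeal_idealD.mul_normal
  have hmem : ∀ c, c ∈ N ↔ c ∈ S.idealD := fun c => Set.ext_iff.mp hND c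
  have hd' : g * d * g⁻¹ ∈ S.idealD := by
    rw [← hmem] at hd ⊢
    exact hN.conj_mem d hd g
  refine ⟨_, S.lamOf_conj_mem_permD' g hc, _, hd', ?_⟩
  simp only [map_mul, map_inv]
  group

theorem sigma_conj_mem_permDD (z : X) {p : Perm X} (hp : p ∈ S.permDD) :
    S.sigma z * p * (S.sigma z)⁻¹ ∈ S.permDD := by
  obtain ⟨c, hc, d, hd, rfl⟩ := hp
  -- the commutator of `sigma z` and `lamOf d` is `sigma z * (sigma (lamOf d z))⁻¹`
  have e : S.sigma z * (c * S.lamOf d) * (S.sigma z)⁻¹ =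
      (S.sigma z * c * (S.sigma z)⁻¹) * (S.sigma z * (S.sigma (S.lamOf d z))⁻¹) * S.lamOf d := by
    rw [← lamOf_mul_sigma]; group
  rw [e]
  exact ⟨_, mul_mem (S.sigma_conj_mem_permD' z hc) (S.sigma_mul_inv_mem _ _), d, hd, rfl⟩

/-- The relation of lying in the same orbit of `D' ⋊ D`. -/
def orbitSetoid : Setoid X where
  r x y := ∃ p ∈ S.permDD, p x = y
  iseqv :=
    { refl := fun x => ⟨1, one_mem _, rfl⟩
      symm := by
        rintro x _ ⟨p, hp, rfl⟩
        exact ⟨p⁻¹, inv_mem hp, inv_apply_aux p x⟩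
      trans := by
        rintro x _ _ ⟨p, hp, rfl⟩ ⟨q, hq, rfl⟩
        exact ⟨q * p, mul_mem hq hp, rfl⟩ }

theorem lam_mul_inv_mem_permDD (x x' : X) : S.lam x' * (S.lam x)⁻¹ ∈ S.permDD := by
  have h := S.lamOf_conj_mem_permDD (S.gamma x) (S.lamOf_mem_permDD
    (S.isIdeal_idealD.inv_mul_mem (S.neg_gamma_add_gamma_mem x x')))
  simpa [mul_assoc] using h

theorem sigma_mul_inv_mem_permDD (x x' : X) : S.sigma x' * (S.sigma x)⁻¹ ∈ S.permDD :=
  S.mem_permDD_of_mem_permD' (S.sigma_mul_inv_mem x' x)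

theorem isCongruence_orbitSetoid : S.IsCongruence S.orbitSetoid where
  lam_left {x x'} _ y := ⟨_, S.lam_mul_inv_mem_permDD x x', by simp⟩
  lam_right x := by
    rintro y _ ⟨p, hp, rfl⟩
    exact ⟨_, S.lamOf_conj_mem_permDD (S.gamma x) hp, by simp⟩
  sigma_left {x x'} _ y := ⟨_, S.sigma_mul_inv_mem_permDD x x', by simp⟩
  sigma_right x := by
    rintro y _ ⟨p, hp, rfl⟩
    exact ⟨_, S.sigma_conj_mem_permDD x hp, by simp⟩

theorem exists_smul_of_orbitSetoid {x y : X} (h : S.orbitSetoid x y) :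
    ∃ s ∈ S.idealDD, s • x = y := by
  obtain ⟨_, ⟨c, hc, d, hd, rfl⟩, rfl⟩ := h
  rw [← subgroupD'_map] at hc
  obtain ⟨c, hc, rfl⟩ := hc
  exact ⟨⟨c, d⟩, ⟨hc, hd⟩, rfl⟩

/-! ### Functoriality of the permutation skew left brace -/

variable {S} {Y : Type u} [Finite Y] {T : NondegSolution Y} {f : X → Y}

theorem map_sigma (hf : S.IsMorphism T.toYBSolution f) (x y : X) :
    f (S.sigma x y) = T.sigma (f x) (f y) := by
  rw [sigma_apply, sigma_apply, map_lam hf, map_rho hf, map_inv_of_map (map_lam hf y)]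

/-- An epimorphism of solutions induces a homomorphism of permutation skew left braces. -/
theorem exists_permBrace_hom (hf : S.IsMorphism T.toYBSolution f) (hs : Function.Surjective f) :
    ∃ F : S.PermBrace →+ T.PermBrace, (∀ g h, F (g * h) = F g * F h) ∧
      (∀ x, F (S.gamma x) = T.gamma (f x)) ∧ ∀ g x, f (S.lamOf g x) = T.lamOf (F g) (f x) := by
  have hex : ∀ g : S.PermBrace, ∃ g' : T.PermBrace,
      (∀ x, f (S.lamOf g x) = T.lamOf g' (f x)) ∧
      ∀ x, f (S.sigmaInvOf g x) = T.sigmaInvOf g' (f x) := by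
    intro g
    induction g using S.permBrace_induction with
    | one => exact ⟨1, fun x => rfl, fun x => rfl⟩
    | mul g y ih =>
      obtain ⟨g', h1, h2⟩ := ih
      refine ⟨g' * T.gamma (f y), fun x => ?_, fun x => ?_⟩
      · simp [h1, map_lam hf]
      · simp only [sigmaInvOf_mul, sigmaInvOf_gamma, Perm.mul_apply]
        rw [h2, h1, map_inv_of_map (map_sigma hf y), map_inv_of_map h1]
  have huniq : ∀ g' g'' : T.PermBrace, (∀ x, T.lamOf g' (f x) = T.lamOf g'' (f x)) →
      (∀ x, T.sigmaInvOf g' (f x) = T.sigmaInvOf g'' (f x)) → g' = g'' := by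
    intro g' g'' h1 h2
    refine T.permBrace_ext ?_ ?_
    · ext y; obtain ⟨x, rfl⟩ := hs y; exact h2 x
    · ext y; obtain ⟨x, rfl⟩ := hs y; exact h1 x
  choose F hF1 hF2 using hex
  have hmul : ∀ g h, F (g * h) = F g * F h := by
    intro g h
    refine huniq _ _ (fun x => ?_) fun x => ?_
    · rw [← hF1, map_mul, map_mul, Perm.mul_apply, Perm.mul_apply, hF1, hF1]
    · rw [← hF2, sigmaInvOf_mul, sigmaInvOf_mul]
      simp only [Perm.mul_apply]
      rw [hF2, hF1, hF2, map_inv_of_map (hF1 g)]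
  have hgamma : ∀ x, F (S.gamma x) = T.gamma (f x) := by
    intro x
    refine huniq _ _ (fun y => ?_) fun y => ?_
    · rw [← hF1]; exact map_lam hf x y
    · rw [← hF2]; exact map_inv_of_map (map_sigma hf x) y
  have hadd1 : ∀ g x, F (g + S.gamma x) = F g + T.gamma (f x) := by
    intro g x
    rw [add_gamma, add_gamma, hmul, hgamma, map_inv_of_map (hF1 g)]
  have hadd : ∀ g h, F (g + h) = F g + F h := by
    intro g h
    induction h using S.permBrace_add_induction with
    | zero =>
      have h0 : F 0 = 0 := by
        refine huniq _ _ (fun x => ?_) fun x => ?_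
        · rw [← hF1]; rfl
        · rw [← hF2]; rfl
      rw [h0, add_zero, add_zero]
    | add h x ih => rw [← add_assoc, hadd1, hadd1, ih, add_assoc]
  exact ⟨AddMonoidHom.mk' F hadd, hmul, hgamma, hF1⟩

/-- If `gamma` is constant on the image of `f`, then `D'` preserves the fibres of `f`. -/
theorem map_subgroupD' (hf : S.IsMorphism T.toYBSolution f)
    (h : ∀ x y, T.gamma (f x) = T.gamma (f y)) {c : S.sigmaGroup} (hc : c ∈ S.subgroupD') (z : X) :
    f ((c : Perm X) z) = f z := by
  induction hc using Subgroup.closure_induction generalizing z with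
  | mem c hc =>
    obtain ⟨⟨x, y⟩, rfl⟩ := hc
    change f (S.sigma x ((S.sigma y)⁻¹ z)) = f z
    rw [map_sigma hf, (T.gamma_eq_iff.mp (h x y)).2, ← map_sigma hf, apply_inv_aux]
  | one => rfl
  | mul c d _ _ hc hd => exact (hc _).trans (hd z)
  | inv c _ hc =>
    rw [← hc]
    exact congrArg f (apply_inv_aux (c : Perm X) z)

/-- An epimorphic image of a finite non-degenerate solution is non-degenerate. -/
def ofMorphism {T : YBSolution Y} (hf : S.IsMorphism T f) (hs : Function.Surjective f) :
    NondegSolution Y where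
  toYBSolution := T
  lam_bijective y := by
    rw [← Finite.surjective_iff_bijective]
    obtain ⟨x, rfl⟩ := hs y
    intro z
    obtain ⟨w, rfl⟩ := hs z
    obtain ⟨v, hv⟩ := (S.lam_bijective x).2 w
    exact ⟨f v, by simp only [hf x v]; exact congrArg f hv⟩
  rho_bijective y := by
    rw [← Finite.surjective_iff_bijective]
    obtain ⟨x, rfl⟩ := hs y
    intro z
    obtain ⟨w, rfl⟩ := hs z
    obtain ⟨v, hv⟩ := (S.rho_bijective x).2 w
    exact ⟨f v, by simp only [hf v x]; exact congrArg f hv⟩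

/-! ### The characterization of simple solutions -/

theorem isIrretractable_of_isSimple [Nonempty X] (hS : S.IsSimple) (hL : ¬ S.IsLyubashenko) :
    S.IsIrretractable := by
  have e : ∀ x y, S.idealSetoid ⊥ x y ↔ S.gamma x = S.gamma y := fun x y => by
    change -S.gamma x + S.gamma y ∈ (⊥ : AddSubgroup S.PermBrace) ↔ _
    rw [AddSubgroup.mem_bot, neg_add_eq_zero]
  rcases (isCongruence_idealSetoid (S := S) IsSkewBrace.IsIdeal.bot).eq_or_total hS with h | h
  · exact fun x y hxy => h x y ((e x y).mpr hxy)
  · exact absurd (S.isLyubashenko_of_const fun x y => (e x y).mp (h x y)) hL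

theorem idealD_le_of_isSimple (hS : S.IsSimple) {I : AddSubgroup S.PermBrace}
    (hI : IsSkewBrace.IsIdeal I) (h0 : I ≠ ⊥) : S.idealD ≤ I := by
  rcases (isCongruence_idealSetoid hI).eq_or_total hS with h | h
  · exact absurd (eq_bot_of_idealSetoid hI h) h0
  · exact (S.idealD_le_iff I hI.add_normal).mpr h

theorem exists_smul_of_isSimple [Nonempty X] (hS : S.IsSimple) (hL : ¬ S.IsLyubashenko) (x y : X) :
    ∃ s ∈ S.idealDD, s • x = y := by
  rcases S.isCongruence_orbitSetoid.eq_or_total hS with h | h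
  · have h1 : ∀ p ∈ S.permDD, p = 1 := fun p hp => by
      ext z
      exact (h z (p z) ⟨p, hp, rfl⟩).symm
    refine absurd (S.isLyubashenko_of_const fun x y => S.gamma_eq_iff.mpr ⟨?_, ?_⟩) hL
    · exact mul_inv_eq_one.mp (h1 _ (S.lam_mul_inv_mem_permDD y x))
    · exact mul_inv_eq_one.mp (h1 _ (S.sigma_mul_inv_mem_permDD y x))
  · exact S.exists_smul_of_orbitSetoid (h x y)

theorem isSimple_of_isLeast [Nonempty X] (h1 : S.IsIrretractable)
    (h2 : S.idealD ∈ lowerBounds {I : AddSubgroup S.PermBrace | IsSkewBrace.IsIdeal I ∧ I ≠ ⊥})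
    (h3 : ∀ x y : X, ∃ s ∈ S.idealDD, s • x = y) : S.IsSimple := by
  intro Y T₀ f hs hf₀
  by_cases hinj : Function.Injective f
  · exact Or.inl ⟨Equiv.ofBijective f ⟨hinj, hs⟩, hf₀⟩
  right
  have : Finite Y := Finite.of_surjective f hs
  let T : NondegSolution Y := ofMorphism hf₀ hs
  have hf : S.IsMorphism T.toYBSolution f := hf₀
  obtain ⟨F, hmul, hgamma, hlam⟩ := exists_permBrace_hom hf hs
  have hne : F.ker ≠ ⊥ := by
    simp only [Function.Injective, not_forall] at hinj
    obtain ⟨x, y, hxy, hne⟩ := hinj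
    intro hk
    have hm : -S.gamma x + S.gamma y ∈ F.ker := by
      rw [AddMonoidHom.mem_ker, map_add, map_neg, hgamma, hgamma, hxy, neg_add_cancel]
    rw [hk, AddSubgroup.mem_bot, neg_add_eq_zero] at hm
    exact hne (h1 hm)
  have hD : S.idealD ≤ F.ker := h2 ⟨IsSkewBrace.isIdeal_ker F hmul, hne⟩
  have hconst : ∀ x y, T.gamma (f x) = T.gamma (f y) := by
    intro x y
    have h := hD (S.neg_gamma_add_gamma_mem x y)
    rwa [AddMonoidHom.mem_ker, map_add, map_neg, hgamma, hgamma, neg_add_eq_zero] at h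
  have hfix : ∀ x y, f x = f y := by
    intro x y
    obtain ⟨s, ⟨hl, hr⟩, rfl⟩ := h3 x y
    change f x = f ((s.left : Perm X) (S.lamOf s.right x))
    rw [map_subgroupD' hf hconst hl, hlam, AddMonoidHom.mem_ker.mp (hD hr)]
    rfl
  rw [Nat.card_eq_one_iff_unique]
  refine ⟨⟨fun a b => ?_⟩, ‹Nonempty X›.map f⟩
  obtain ⟨x, rfl⟩ := hs a
  obtain ⟨y, rfl⟩ := hs b
  exact hfix x y

end NondegSolution

theorem mainTheorem2 {X : Type*} [Finite X] (S : NondegSolution X) (hX : 1 < Nat.card X)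
    (hL : ¬ S.IsLyubashenko) :
    S.IsSimple ↔
      S.IsIrretractable ∧
      IsLeast {I : AddSubgroup S.PermBrace | IsSkewBrace.IsIdeal I ∧ I ≠ ⊥} S.idealD ∧
      ∀ x y : X, ∃ s ∈ S.idealDD, s • x = y := by
  have hnt : Nontrivial X := Finite.one_lt_card_iff_nontrivial.mp hX
  refine ⟨fun hS => ?_, fun ⟨h1, h2, h3⟩ => NondegSolution.isSimple_of_isLeast h1 h2.2 h3⟩
  have hirr := NondegSolution.isIrretractable_of_isSimple hS hL
  refine ⟨hirr, ⟨⟨S.isIdeal_idealD, fun h0 => ?_⟩, fun I hI =>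
    NondegSolution.idealD_le_of_isSimple hS hI.1 hI.2⟩, NondegSolution.exists_smul_of_isSimple hS hL⟩
  obtain ⟨x, y, hxy⟩ := hnt
  have hm := S.neg_gamma_add_gamma_mem x y
  rw [h0, AddSubgroup.mem_bot, neg_add_eq_zero] at hm
  exact hxy (hirr hm)
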